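/- **Theorem 4.3 (all modes).** Let $N\ge 1$, let $\lambda_1,\dots,\lambda_N>0$ be $\mathbb Z$-linearly independent, let $A=(a_{kj})$ be a real $N\times N$ matrix and let $a_1,\dots,a_N,b_1,\dots,b_N\in\mathbb R$. Write $x_+=\max(x,0)$. For $\varepsilon>0$ let $u^\varepsilon=(u_1^\varepsilon,\dots,u_N^\varepsilon)$ be the solution on $[0,\infty)$ of $$\ddot u_k^\varepsilon+\lambda_k^2u_k^\varepsilon=-\varepsilon\Big(\sum_{j=1}^N a_{kj}u_j^\varepsilon-b_k\Big)_+,\qquad u_k^\varepsilon(0)=a_k,\quad \dot u_k^\varepsilon(0)=0,\qquad k=1,\dots,N.$$ Then for every $k$ the limit $$m_k=\lim_{T\to+\infty}\frac1T\int_0^T\Big(\sum_{j=1}^N a_{kj}a_j\cos\big(\tfrac{\lambda_j}{\lambda_k}s\big)-b_k\Big)_+\cos(s)\,ds$$ exists. Put $\lambda_k^1=\dfrac{m_k}{\lambda_k a_k}$ if $a_k\neq0$ (if $a_k=0$, the value of $\lambda_k^1$ is immaterial; set $\lambda_k^1=0$), and $\lambda_k^\varepsilon=\lambda_k+\varepsilon\lambda_k^1$.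 For every choice of $T_\varepsilon$ with $T_\varepsilon\to+\infty$ and $\varepsilon T_\varepsilon\to0$ as $\varepsilon\to0^+$, and for every $k=1,\dots,N$, $$\lim_{\varepsilon\to0^+}\big\|u_k^\varepsilon(t)-a_k\cos(\lambda_k^\varepsilon t)\big\|_{W^{2,\infty}(0,T_\varepsilon)}=0.$$ Furthermore, if $b_k=0$ and $a_k\ne0$, then $\lambda_k^1=\dfrac{a_{kk}}{4\lambda_k}$. -/

import Mathlib

open MeasureTheory Filter Topology Set
open scoped ContDiff ENNReal

noncomputable section

namespace UnilateralSpring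

/-- `g` is the weak derivative of `f` on the open set `Ω ⊆ ℝ`. -/
def HasWeakDerivOn (Ω : Set ℝ) (f g : ℝ → ℝ) : Prop :=
  LocallyIntegrableOn f Ω ∧ LocallyIntegrableOn g Ω ∧
    ∀ φ : ℝ → ℝ, ContDiff ℝ ∞ φ → HasCompactSupport φ → tsupport φ ⊆ Ω →
      ∫ x in Ω, f x * deriv φ x = -∫ x in Ω, g x * φ x

/-- The norm of `W^{2,∞}(Ω)`, namely the sum of the `L^∞(Ω)` norms of `f` and of its first two weak
derivatives. Weak derivatives are unique almost everywhere, so the infimum runs over a set with at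
most one value; it is `∞` when `f` is not in `W^{2,∞}(Ω)`. -/
def sobolevNormTwoInfty (Ω : Set ℝ) (f : ℝ → ℝ) : ℝ≥0∞ :=
  ⨅ (g : ℝ → ℝ) (h : ℝ → ℝ) (_ : HasWeakDerivOn Ω f g) (_ : HasWeakDerivOn Ω g h),
    eLpNorm f ∞ (volume.restrict Ω) + eLpNorm g ∞ (volume.restrict Ω) +
      eLpNorm h ∞ (volume.restrict Ω)

/-- `u = (u_1, …, u_N)` is a classical solution on `[0, ∞)` of
`u_k'' + λ_k² u_k = - ε (∑_j A_{kj} u_j - b_k)_+`, `u_k(0) = a_k`, `u_k'(0) = 0`.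
Derivatives at `0` are one-sided. -/
def IsSolution {N : ℕ} (lam a b : Fin N → ℝ) (A : Matrix (Fin N) (Fin N) ℝ) (ε : ℝ)
    (u : Fin N → ℝ → ℝ) : Prop :=
  ∃ v : Fin N → ℝ → ℝ,
    (∀ k, u k 0 = a k ∧ v k 0 = 0) ∧
    ∀ k, ∀ t ∈ Ici (0 : ℝ),
      HasDerivWithinAt (u k) (v k t) (Ici 0) t ∧
      HasDerivWithinAt (v k)
        (-(lam k ^ 2 * u k t) - ε * max (∑ j, A k j * u j t - b k) 0) (Ici 0) t

/-- `(1/T) ∫_0^T (∑_j A_{kj} a_j cos((λ_j/λ_k) s) - b_k)_+ cos s ds`. -/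
def resonantMean {N : ℕ} (lam a b : Fin N → ℝ) (A : Matrix (Fin N) (Fin N) ℝ) (k : Fin N)
    (T : ℝ) : ℝ :=
  1 / T * ∫ s in (0 : ℝ)..T,
    max (∑ j, A k j * (a j * Real.cos (lam j / lam k * s)) - b k) 0 * Real.cos s

/-- The frequency correction `λ_k^1`: `1 / (λ_k a_k)` times the limit of the means above as
`T → ∞`. (If `a_k = 0`, the approximation `a_k cos(λ_k^ε t)` vanishes and the value of `λ_k^1` is
immaterial; here it is `0`.) -/
def frequencyCorrection {N : ℕ} (lam a b : Fin N → ℝ) (A : Matrix (Fin N) (Fin N) ℝ)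
    (k : Fin N) : ℝ :=
  1 / (lam k * a k) * limUnder atTop (resonantMean lam a b A k)

end UnilateralSpring

end

namespace UnilateralSpring

/-- The continuous function `f` has asymptotic mean `m` on `[0, ∞)`. -/
def HasMean (f : ℝ → ℝ) (m : ℝ) : Prop :=
  Tendsto (fun T : ℝ => 1 / T * ∫ s in (0 : ℝ)..T, f s) atTop (𝓝 m)

theorem HasMean.add {f g : ℝ → ℝ} {m n : ℝ} (hf : Continuous f) (hg : Continuous g)
    (h : HasMean f m) (h' : HasMean g n) : HasMean (fun s => f s + g s) (m + n) := by
  refine (Tendsto.add h h').congr fun T => ?_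
  rw [intervalIntegral.integral_add (hf.intervalIntegrable _ _) (hg.intervalIntegrable _ _)]
  ring

theorem HasMean.const_mul {f : ℝ → ℝ} {m : ℝ} (c : ℝ) (h : HasMean f m) :
    HasMean (fun s => c * f s) (c * m) := by
  refine (Tendsto.const_mul c h).congr fun T => ?_
  rw [intervalIntegral.integral_const_mul]
  ring

theorem hasMean_zero : HasMean (fun _ => 0) 0 := by
  simp [HasMean]

theorem HasMean.sum {ι : Type*} (t : Finset ι) {f : ι → ℝ → ℝ} {m : ι → ℝ}
    (hf : ∀ i ∈ t, Continuous (f i)) (h : ∀ i ∈ t, HasMean (f i) (m i)) :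
    HasMean (fun s => ∑ i ∈ t, f i s) (∑ i ∈ t, m i) := by
  classical
  induction t using Finset.induction_on with
  | empty => simpa using hasMean_zero
  | insert i t hi ih =>
    simp only [Finset.sum_insert hi]
    exact (h i (by simp)).add (hf i (by simp))
      (continuous_finsetSum _ fun j hj => hf j (by simp [hj]))
      (ih (fun j hj => hf j (by simp [hj])) fun j hj => h j (by simp [hj]))

theorem hasMean_cos (μ : ℝ) : HasMean (fun s => Real.cos (μ * s)) (if μ = 0 then 1 else 0) := by
  split_ifs with h
  · subst h
    refine tendsto_const_nhds.congr' ?_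
    filter_upwards [eventually_gt_atTop 0] with T hT
    simp [hT.ne']
  · have hz : Tendsto (fun T : ℝ => 1 / |μ| * T⁻¹) atTop (𝓝 0) := by
      simpa using tendsto_inv_atTop_zero.const_mul (1 / |μ|)
    refine squeeze_zero_norm' ?_ hz
    filter_upwards [eventually_gt_atTop 0] with T hT
    rw [intervalIntegral.integral_comp_mul_left _ h, integral_cos]
    simp only [mul_zero, Real.sin_zero, sub_zero, smul_eq_mul, norm_mul, Real.norm_eq_abs,
      abs_inv, one_div, abs_of_pos hT]
    have := Real.abs_sin_le_one (μ * T)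
    calc T⁻¹ * (|μ|⁻¹ * |Real.sin (μ * T)|) ≤ T⁻¹ * (|μ|⁻¹ * 1) := by gcongr
      _ = |μ|⁻¹ * T⁻¹ := by ring

theorem abs_mean_sub_le {f g : ℝ → ℝ} (hf : Continuous f) (hg : Continuous g) {δ T : ℝ}
    (h : ∀ s, |f s - g s| ≤ δ) (hT : 0 < T) :
    |1 / T * (∫ s in (0 : ℝ)..T, f s) - 1 / T * ∫ s in (0 : ℝ)..T, g s| ≤ δ := by
  rw [← mul_sub, ← intervalIntegral.integral_sub (hf.intervalIntegrable _ _)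
    (hg.intervalIntegrable _ _), abs_mul, abs_of_pos (by positivity : 0 < 1 / T)]
  have := intervalIntegral.norm_integral_le_of_norm_le_const (a := 0) (b := T)
    (f := fun s => f s - g s) (C := δ) fun s _ => h s
  rw [sub_zero, abs_of_pos hT, Real.norm_eq_abs] at this
  calc _ ≤ 1 / T * (δ * T) := by gcongr
    _ = δ := by field_simp

theorem exists_hasMean_of_approx {f : ℝ → ℝ} (hf : Continuous f)
    (h : ∀ δ > 0, ∃ g m, Continuous g ∧ HasMean g m ∧ ∀ s, |f s - g s| ≤ δ) :
    ∃ m, HasMean f m := by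
  refine cauchySeq_tendsto_of_complete (Metric.cauchySeq_iff'.2 fun δ hδ => ?_)
  obtain ⟨g, m, hg, hm, hfg⟩ := h (δ / 5) (by positivity)
  obtain ⟨M, hM⟩ := eventually_atTop.1 ((Metric.tendsto_nhds.1 hm (δ / 5) (by positivity)).and
    (eventually_gt_atTop 0))
  refine ⟨M, fun T hT => ?_⟩
  have h1 := hM T hT
  have h2 := hM M le_rfl
  have h3 := abs_mean_sub_le hf hg hfg h1.2
  have h4 := abs_mean_sub_le hf hg hfg h2.2
  have h5 := h1.1
  have h6 := h2.1
  rw [Real.dist_eq] at *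
  rw [abs_le] at h3 h4
  rw [abs_lt] at *
  constructor <;> linarith

theorem hasMean_zero_of_approx {f : ℝ → ℝ} (hf : Continuous f)
    (h : ∀ δ > 0, ∃ g, Continuous g ∧ HasMean g 0 ∧ ∀ s, |f s - g s| ≤ δ) :
    HasMean f 0 := by
  refine Metric.tendsto_nhds.2 fun δ hδ => ?_
  obtain ⟨g, hg, hm, hfg⟩ := h (δ / 2) (by positivity)
  filter_upwards [Metric.tendsto_nhds.1 hm (δ / 2) (by positivity), eventually_gt_atTop 0]
    with T h1 h2
  have h3 := abs_mean_sub_le hf hg hfg h2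
  rw [Real.dist_eq] at *
  rw [abs_le] at h3
  rw [abs_lt] at *
  constructor <;> linarith

/-- The real span of the functions `cos (μ s)` with frequency `μ ∈ D`. -/
def cosSpan (D : Set ℝ) : Submodule ℝ (ℝ → ℝ) :=
  Submodule.span ℝ ((fun μ s => Real.cos (μ * s)) '' D)

theorem cos_mem_cosSpan {D : Set ℝ} {μ : ℝ} (h : μ ∈ D) :
    (fun s => Real.cos (μ * s)) ∈ cosSpan D :=
  Submodule.subset_span ⟨μ, h, rfl⟩

theorem mul_mem_cosSpan {D E F : Set ℝ} (hadd : ∀ x ∈ D, ∀ y ∈ E, x + y ∈ F)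
    (hsub : ∀ x ∈ D, ∀ y ∈ E, x - y ∈ F) {f g : ℝ → ℝ} (hf : f ∈ cosSpan D)
    (hg : g ∈ cosSpan E) : f * g ∈ cosSpan F := by
  have h : cosSpan D * cosSpan E ≤ cosSpan F := by
    rw [cosSpan, cosSpan, Submodule.span_mul_span, Submodule.span_le]
    rintro _ ⟨_, ⟨x, hx, rfl⟩, _, ⟨y, hy, rfl⟩, rfl⟩
    have : (fun s => Real.cos (x * s)) * (fun s => Real.cos (y * s)) =
        (1 / 2 : ℝ) • ((fun s => Real.cos ((x + y) * s)) + fun s => Real.cos ((x - y) * s)) := by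
      ext s
      simp only [Pi.mul_apply, Pi.smul_apply, Pi.add_apply, smul_eq_mul, add_mul, sub_mul,
        Real.cos_add, Real.cos_sub]
      ring
    simp only [this]
    exact Submodule.smul_mem _ _ (Submodule.add_mem _ (cos_mem_cosSpan (hadd x hx y hy))
      (cos_mem_cosSpan (hsub x hx y hy)))
  exact h (Submodule.mul_mem_mul hf hg)

theorem polynomial_mem_cosSpan {D : Set ℝ} (h0 : 0 ∈ D) (hadd : ∀ x ∈ D, ∀ y ∈ D, x + y ∈ D)
    (hsub : ∀ x ∈ D, ∀ y ∈ D, x - y ∈ D) {f : ℝ → ℝ} (hf : f ∈ cosSpan D)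
    (p : Polynomial ℝ) : (fun s => p.eval (f s)) ∈ cosSpan D := by
  have hone : (1 : ℝ → ℝ) ∈ cosSpan D := by
    convert cos_mem_cosSpan h0 using 1
    ext s
    simp
  have hpow (n : ℕ) : f ^ n ∈ cosSpan D := by
    induction n with
    | zero => simpa using hone
    | succ n ih => rw [pow_succ]; exact mul_mem_cosSpan hadd hsub ih hf
  have : (fun s => p.eval (f s)) = ∑ i ∈ Finset.range (p.natDegree + 1), p.coeff i • f ^ i := by
    ext s
    simp [Polynomial.eval_eq_sum_range]
  rw [this]
  exact Submodule.sum_mem _ fun i _ => Submodule.smul_mem _ _ (hpow i)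

theorem continuous_of_mem_cosSpan {D : Set ℝ} {f : ℝ → ℝ} (hf : f ∈ cosSpan D) :
    Continuous f := by
  induction hf using Submodule.span_induction with
  | mem x hx => obtain ⟨μ, _, rfl⟩ := hx; fun_prop
  | zero => exact continuous_const
  | add x y _ _ hx hy => exact hx.add hy
  | smul c x _ hx => exact hx.const_smul c

theorem bounded_of_mem_cosSpan {D : Set ℝ} {f : ℝ → ℝ} (hf : f ∈ cosSpan D) :
    ∃ M, ∀ s, |f s| ≤ M := by
  induction hf using Submodule.span_induction with
  | mem x hx => obtain ⟨μ, _, rfl⟩ := hx; exact ⟨1, fun s => Real.abs_cos_le_one _⟩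
  | zero => exact ⟨0, by simp⟩
  | add x y _ _ hx hy =>
    obtain ⟨M, hM⟩ := hx
    obtain ⟨L, hL⟩ := hy
    exact ⟨M + L, fun s => (abs_add_le _ _).trans (add_le_add (hM s) (hL s))⟩
  | smul c x _ hx =>
    obtain ⟨M, hM⟩ := hx
    exact ⟨|c| * M, fun s => by
      simpa [abs_mul] using mul_le_mul_of_nonneg_left (hM s) (abs_nonneg c)⟩

theorem exists_hasMean_of_mem_cosSpan {D : Set ℝ} {f : ℝ → ℝ} (hf : f ∈ cosSpan D) :
    ∃ m, HasMean f m := by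
  induction hf using Submodule.span_induction with
  | mem x hx => obtain ⟨μ, _, rfl⟩ := hx; exact ⟨_, hasMean_cos μ⟩
  | zero => exact ⟨0, hasMean_zero⟩
  | add x y hx' hy' hx hy =>
    obtain ⟨m, hm⟩ := hx
    obtain ⟨n, hn⟩ := hy
    exact ⟨m + n, hm.add (continuous_of_mem_cosSpan hx') (continuous_of_mem_cosSpan hy') hn⟩
  | smul c x _ hx =>
    obtain ⟨m, hm⟩ := hx
    exact ⟨c * m, hm.const_mul c⟩

theorem hasMean_zero_of_mem_cosSpan {D : Set ℝ} (h0 : 0 ∉ D) {f : ℝ → ℝ}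
    (hf : f ∈ cosSpan D) : HasMean f 0 := by
  induction hf using Submodule.span_induction with
  | mem x hx =>
    obtain ⟨μ, hμ, rfl⟩ := hx
    simpa [ne_of_mem_of_not_mem hμ h0] using hasMean_cos μ
  | zero => exact hasMean_zero
  | add x y hx' hy' hx hy =>
    have := hx.add (continuous_of_mem_cosSpan hx') (continuous_of_mem_cosSpan hy') hy
    rwa [add_zero] at this
  | smul c x _ hx =>
    have := hx.const_mul c
    rwa [mul_zero] at this

/-- A continuous function of a bounded one is a uniform limit of polynomials in it. -/
theorem exists_polynomial_comp_near {F f : ℝ → ℝ} (hF : Continuous F) {M : ℝ}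
    (hM : ∀ s, |f s| ≤ M) {δ : ℝ} (hδ : 0 < δ) :
    ∃ p : Polynomial ℝ, ∀ s, |F (f s) - p.eval (f s)| ≤ δ := by
  obtain ⟨p, hp⟩ := exists_polynomial_near_of_continuousOn (-M) M F hF.continuousOn δ hδ
  refine ⟨p, fun s => ?_⟩
  rw [abs_sub_comm]
  exact (hp (f s) (abs_le.1 (hM s))).le

theorem abs_mul_cos_sub_le {x y δ : ℝ} (h : |x - y| ≤ δ) (θ : ℝ) :
    |x * Real.cos θ - y * Real.cos θ| ≤ δ := by
  rw [← sub_mul, abs_mul]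
  exact (mul_le_of_le_one_right (abs_nonneg _) (Real.abs_cos_le_one _)).trans h

theorem exists_hasMean_comp_mul_cos {F f : ℝ → ℝ} (hF : Continuous F) (hf : f ∈ cosSpan univ) :
    ∃ m, HasMean (fun s => F (f s) * Real.cos s) m := by
  have hfc := continuous_of_mem_cosSpan hf
  obtain ⟨M, hM⟩ := bounded_of_mem_cosSpan hf
  refine exists_hasMean_of_approx (by fun_prop) fun δ hδ => ?_
  obtain ⟨p, hp⟩ := exists_polynomial_comp_near hF hM hδ
  have hcos : (fun s => Real.cos s) ∈ cosSpan univ := by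
    simpa using cos_mem_cosSpan (mem_univ (1 : ℝ))
  have hmem := mul_mem_cosSpan (F := univ) (by simp) (by simp)
    (polynomial_mem_cosSpan (by simp) (by simp) (by simp) hf p) hcos
  obtain ⟨m, hm⟩ := exists_hasMean_of_mem_cosSpan hmem
  exact ⟨_, m, continuous_of_mem_cosSpan hmem, hm, fun s => abs_mul_cos_sub_le (hp s) s⟩

/-- Integer combinations of `ν` whose coefficients have a sum of the given parity. -/
def parityFrequencies {N : ℕ} (ν : Fin N → ℝ) (r : ZMod 2) : Set ℝ :=
  {μ | ∃ n : Fin N → ℤ, ((∑ j, n j : ℤ) : ZMod 2) = r ∧ μ = ∑ j, n j * ν j}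

section Parity

variable {N : ℕ} {ν : Fin N → ℝ} {r r' r'' : ZMod 2} {x y : ℝ}

theorem add_mem_parityFrequencies (hx : x ∈ parityFrequencies ν r)
    (hy : y ∈ parityFrequencies ν r') (h : r + r' = r'') :
    x + y ∈ parityFrequencies ν r'' := by
  subst h
  obtain ⟨n, rfl, rfl⟩ := hx
  obtain ⟨m, rfl, rfl⟩ := hy
  exact ⟨n + m, by simp [Finset.sum_add_distrib], by simp [Finset.sum_add_distrib, add_mul]⟩

theorem sub_mem_parityFrequencies (hx : x ∈ parityFrequencies ν r)
    (hy : y ∈ parityFrequencies ν r') (h : r + r' = r'') :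
    x - y ∈ parityFrequencies ν r'' := by
  subst h
  obtain ⟨n, rfl, rfl⟩ := hx
  obtain ⟨m, rfl, rfl⟩ := hy
  exact ⟨n - m, by simp [Finset.sum_sub_distrib, CharTwo.sub_eq_add],
    by simp [Finset.sum_sub_distrib, sub_mul]⟩

theorem apply_mem_parityFrequencies (ν : Fin N → ℝ) (j : Fin N) :
    ν j ∈ parityFrequencies ν 1 :=
  ⟨Pi.single j 1, by simp [Finset.sum_pi_single'], by simp [Pi.single_apply]⟩

theorem zero_mem_parityFrequencies (ν : Fin N → ℝ) : 0 ∈ parityFrequencies ν 0 :=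
  ⟨0, by simp, by simp⟩

theorem zero_notMem_parityFrequencies_one (hν : LinearIndependent ℤ ν) :
    0 ∉ parityFrequencies ν 1 := by
  rintro ⟨n, hn, h⟩
  have := Fintype.linearIndependent_iff.1 hν n (by simpa using h.symm)
  simp [this] at hn

end Parity

theorem hasMean_abs_mul_cos {N : ℕ} {ν : Fin N → ℝ} (hν : LinearIndependent ℤ ν) {k : Fin N}
    (hk : ν k = 1) {f : ℝ → ℝ} (hf : f ∈ cosSpan (parityFrequencies ν 1)) :
    HasMean (fun s => |f s| * Real.cos s) 0 := by
  have hfc := continuous_of_mem_cosSpan hf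
  have h2 : (f * f) ∈ cosSpan (parityFrequencies ν 0) :=
    mul_mem_cosSpan (fun x hx y hy => add_mem_parityFrequencies hx hy (by decide))
      (fun x hx y hy => sub_mem_parityFrequencies hx hy (by decide)) hf hf
  obtain ⟨M, hM⟩ := bounded_of_mem_cosSpan h2
  have hcos : (fun s => Real.cos s) ∈ cosSpan (parityFrequencies ν 1) := by
    simpa [hk] using cos_mem_cosSpan (apply_mem_parityFrequencies ν k)
  refine hasMean_zero_of_approx (by fun_prop) fun δ hδ => ?_
  obtain ⟨p, hp⟩ := exists_polynomial_comp_near Real.continuous_sqrt hM hδ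
  have hadd {r : ZMod 2} (x) (hx : x ∈ parityFrequencies ν 0) (y)
      (hy : y ∈ parityFrequencies ν r) : x + y ∈ parityFrequencies ν r :=
    add_mem_parityFrequencies hx hy (zero_add r)
  have hsub {r : ZMod 2} (x) (hx : x ∈ parityFrequencies ν 0) (y)
      (hy : y ∈ parityFrequencies ν r) : x - y ∈ parityFrequencies ν r :=
    sub_mem_parityFrequencies hx hy (zero_add r)
  have hmem := mul_mem_cosSpan hadd hsub
    (polynomial_mem_cosSpan (zero_mem_parityFrequencies ν) hadd hsub h2 p) hcos
  refine ⟨_, continuous_of_mem_cosSpan hmem,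
    hasMean_zero_of_mem_cosSpan (zero_notMem_parityFrequencies_one hν) hmem, fun s => ?_⟩
  have := hp s
  rw [Pi.mul_apply, Real.sqrt_mul_self_eq_abs] at this
  exact abs_mul_cos_sub_le this s

theorem hasMean_sum_cos_mul_cos {N : ℕ} {ν : Fin N → ℝ} (hpos : ∀ j, 0 < ν j)
    (hinj : Function.Injective ν) {k : Fin N} (hk : ν k = 1) (c : Fin N → ℝ) :
    HasMean (fun s => (∑ j, c j * Real.cos (ν j * s)) * Real.cos s) (c k / 2) := by
  have h (j : Fin N) : HasMean (fun s => c j / 2 * (Real.cos ((ν j + 1) * s) +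
      Real.cos ((ν j - 1) * s))) (c j / 2 * (if j = k then 1 else 0)) := by
    have h1 := hasMean_cos (ν j + 1)
    have h2 := hasMean_cos (ν j - 1)
    rw [if_neg (by linarith [hpos j])] at h1
    have hiff : ν j - 1 = 0 ↔ j = k := by rw [sub_eq_zero, ← hk, hinj.eq_iff]
    simp only [hiff] at h2
    simpa using (h1.add (by fun_prop) (by fun_prop) h2).const_mul (c j / 2)
  have hsum := HasMean.sum Finset.univ (fun j _ => by fun_prop) fun j _ => h j
  convert hsum using 1
  · ext s
    rw [Finset.sum_mul]
    refine Finset.sum_congr rfl fun j _ => ?_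
    rw [add_mul, sub_mul, one_mul, Real.cos_add, Real.cos_sub]
    ring
  · simp

section ResonantMean

variable {N : ℕ} {lam a b : Fin N → ℝ} {A : Matrix (Fin N) (Fin N) ℝ}

theorem sum_cos_mem_cosSpan {N : ℕ} {D : Set ℝ} {ν : Fin N → ℝ} (hν : ∀ j, ν j ∈ D)
    (c : Fin N → ℝ) : (fun s => ∑ j, c j * Real.cos (ν j * s)) ∈ cosSpan D := by
  have : (fun s => ∑ j, c j * Real.cos (ν j * s)) =
      ∑ j, c j • fun s => Real.cos (ν j * s) := by
    ext s
    simp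
  rw [this]
  exact Submodule.sum_mem _ fun j _ => Submodule.smul_mem _ _ (cos_mem_cosSpan (hν j))

theorem exists_tendsto_resonantMean (lam a b : Fin N → ℝ) (A : Matrix (Fin N) (Fin N) ℝ)
    (k : Fin N) : ∃ m : ℝ, Tendsto (resonantMean lam a b A k) atTop (𝓝 m) := by
  obtain ⟨m, hm⟩ := exists_hasMean_comp_mul_cos (F := fun x => max (x - b k) 0) (by fun_prop)
    (sum_cos_mem_cosSpan (D := univ) (ν := fun j => lam j / lam k) (by simp)
      fun j => A k j * a j)
  refine ⟨m, hm.congr fun T => ?_⟩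
  simp only [resonantMean, mul_assoc]

theorem tendsto_resonantMean_of_eq_zero (hpos : ∀ k, 0 < lam k)
    (hind : LinearIndependent ℤ lam) (a : Fin N → ℝ) (A : Matrix (Fin N) (Fin N) ℝ) {k : Fin N}
    (hb : b k = 0) : Tendsto (resonantMean lam a b A k) atTop (𝓝 (A k k * a k / 4)) := by
  have hk := hpos k
  set ν : Fin N → ℝ := fun j => lam j / lam k with hνdef
  have hνk : ν k = 1 := div_self hk.ne'
  have hν : LinearIndependent ℤ ν := by
    rw [Fintype.linearIndependent_iff] at hind ⊢
    intro n hn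
    refine hind n ?_
    have : ∑ j, n j • lam j = (∑ j, n j • ν j) * lam k := by
      rw [Finset.sum_mul]
      refine Finset.sum_congr rfl fun j _ => ?_
      simp only [zsmul_eq_mul, hνdef]
      field_simp
    rw [this, hn, zero_mul]
  have hc := sum_cos_mem_cosSpan (apply_mem_parityFrequencies ν) fun j => A k j * a j
  have h1 := hasMean_abs_mul_cos hν hνk hc
  have h2 := hasMean_sum_cos_mul_cos (fun j => div_pos (hpos j) hk) hν.injective hνk
    fun j => A k j * a j
  have h3 := (h1.add (by fun_prop) (by fun_prop) h2).const_mul (1 / 2)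
  rw [show 1 / 2 * (0 + A k k * a k / 2) = A k k * a k / 4 by ring] at h3
  refine h3.congr fun T => ?_
  rw [resonantMean]
  congr 1
  refine intervalIntegral.integral_congr fun s _ => ?_
  simp only [hb, sub_zero, ← mul_assoc, hνdef]
  rw [← add_mul, ← mul_assoc]
  congr 1
  rcases le_total 0 (∑ j, A k j * a j * Real.cos (lam j / lam k * s)) with h | h
  · rw [max_eq_left h, abs_of_nonneg h]
    ring
  · rw [max_eq_right h, abs_of_nonpos h]
    ring

end ResonantMean

theorem HasWeakDerivOn.of_hasDerivAt {T : ℝ} (hT : 0 ≤ T) {f g : ℝ → ℝ}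
    (hf : ContinuousOn f (Icc 0 T)) (hg : ContinuousOn g (Icc 0 T))
    (h : ∀ t ∈ Ioo 0 T, HasDerivAt f (g t) t) : HasWeakDerivOn (Ioo 0 T) f g := by
  refine ⟨(hf.mono Ioo_subset_Icc_self).locallyIntegrableOn measurableSet_Ioo,
    (hg.mono Ioo_subset_Icc_self).locallyIntegrableOn measurableSet_Ioo, fun φ hφ _ hsupp => ?_⟩
  have h0 : φ 0 = 0 := image_eq_zero_of_notMem_tsupport fun h => (hsupp h).1.false
  have h1 : φ T = 0 := image_eq_zero_of_notMem_tsupport fun h => (hsupp h).2.false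
  have hI := intervalIntegral.integral_mul_deriv_eq_deriv_mul_of_hasDerivAt (a := 0) (b := T)
    (u := f) (u' := g) (v := φ) (v' := deriv φ) (by rwa [uIcc_of_le hT])
    hφ.continuous.continuousOn (by simpa [hT] using h)
    (fun x _ => (hφ.differentiable (by simp) x).hasDerivAt)
    (ContinuousOn.intervalIntegrable (by rwa [uIcc_of_le hT]))
    ((hφ.continuous_deriv (by simp)).intervalIntegrable _ _)
  simpa [h0, h1, intervalIntegral.integral_of_le hT, integral_Ioc_eq_integral_Ioo] using hI

theorem sobolevNormTwoInfty_le {T : ℝ} (hT : 0 ≤ T) {f g h : ℝ → ℝ}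
    (hf : ContinuousOn f (Icc 0 T)) (hg : ContinuousOn g (Icc 0 T))
    (hh : ContinuousOn h (Icc 0 T)) (hfg : ∀ t ∈ Ioo 0 T, HasDerivAt f (g t) t)
    (hgh : ∀ t ∈ Ioo 0 T, HasDerivAt g (h t) t) {B₀ B₁ B₂ : ℝ}
    (h₀ : ∀ t ∈ Ioo 0 T, |f t| ≤ B₀) (h₁ : ∀ t ∈ Ioo 0 T, |g t| ≤ B₁)
    (h₂ : ∀ t ∈ Ioo 0 T, |h t| ≤ B₂) :
    sobolevNormTwoInfty (Ioo 0 T) f ≤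
      ENNReal.ofReal B₀ + ENNReal.ofReal B₁ + ENNReal.ofReal B₂ := by
  have key {F : ℝ → ℝ} {B : ℝ} (hF : ∀ t ∈ Ioo 0 T, |F t| ≤ B) :
      eLpNorm F ∞ (volume.restrict (Ioo 0 T)) ≤ ENNReal.ofReal B := by
    rw [eLpNorm_exponent_top]
    exact eLpNormEssSup_le_of_ae_bound ((ae_restrict_iff' measurableSet_Ioo).2 (.of_forall hF))
  refine (iInf₂_le_of_le g h <| iInf₂_le_of_le (HasWeakDerivOn.of_hasDerivAt hT hf hg hfg)
    (HasWeakDerivOn.of_hasDerivAt hT hg hh hgh) le_rfl).trans ?_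
  gcongr
  exacts [key h₀, key h₁, key h₂]

variable {N : ℕ} {lam a b : Fin N → ℝ} {A : Matrix (Fin N) (Fin N) ℝ}

theorem abs_max_zero_le_sum (A : Matrix (Fin N) (Fin N) ℝ) (b x : Fin N → ℝ) (k : Fin N) :
    |max (∑ j, A k j * x j - b k) 0| ≤ ∑ j, |A k j| * |x j| + |b k| := by
  have h : |max (∑ j, A k j * x j - b k) 0| ≤ |∑ j, A k j * x j - b k| := by
    rw [abs_of_nonneg (le_max_right _ _)]
    exact max_le (le_abs_self _) (abs_nonneg _)
  refine (h.trans (abs_sub _ _)).trans ?_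
  gcongr
  exact (Finset.abs_sum_le_sum_abs _ _).trans_eq (by simp only [abs_mul])

/-- The force grows at most affinely in the distance to the unperturbed orbit. -/
theorem exists_force_bound (hpos : ∀ k, 0 < lam k) (a b : Fin N → ℝ)
    (A : Matrix (Fin N) (Fin N) ℝ) :
    ∃ C > 0, ∀ k, ∀ x : Fin N → ℝ, ∀ D, 0 ≤ D → (∀ j, |x j| ≤ |a j| + 2 * D) →
      |max (∑ j, A k j * x j - b k) 0| ≤ C * (D + 1) ∧
      |max (∑ j, A k j * x j - b k) 0| / lam k ≤ C * (D + 1) := by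
  set c : Fin N → ℝ := fun k => ∑ j, |A k j| * (|a j| + 2) + |b k| with hc
  have hc0 (k) : 0 ≤ c k := by positivity
  have hterm (k) : 0 ≤ c k * (1 + 1 / lam k) := by have := hpos k; have := hc0 k; positivity
  refine ⟨1 + ∑ k, c k * (1 + 1 / lam k), by
    have := Finset.sum_nonneg fun k (_ : k ∈ Finset.univ) => hterm k
    positivity, fun k x D hD hx => ?_⟩
  have hk := hpos k
  have hle : c k * (1 + 1 / lam k) ≤ 1 + ∑ k, c k * (1 + 1 / lam k) := by
    have := Finset.single_le_sum (fun k (_ : k ∈ Finset.univ) => hterm k) (Finset.mem_univ k)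
    linarith
  have hF : |max (∑ j, A k j * x j - b k) 0| ≤ c k * (D + 1) := by
    refine (abs_max_zero_le_sum A b x k).trans ?_
    rw [hc, add_mul, Finset.sum_mul]
    refine add_le_add (Finset.sum_le_sum fun j _ => ?_) (by nlinarith [abs_nonneg (b k)])
    rw [mul_assoc]
    gcongr
    nlinarith [hx j, abs_nonneg (a j)]
  have hdiv : 0 ≤ c k / lam k := div_nonneg (hc0 k) hk.le
  have hsplit : c k * (1 + 1 / lam k) = c k + c k / lam k := by ring
  constructor
  · exact hF.trans (by gcongr; linarith)
  · calc _ ≤ c k * (D + 1) / lam k := by gcongr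
      _ = c k / lam k * (D + 1) := by ring
      _ ≤ _ := by gcongr; linarith [hc0 k]

theorem hasDerivWithinAt_cos_mul (μ t : ℝ) (s : Set ℝ) :
    HasDerivWithinAt (fun t => Real.cos (μ * t)) (-(μ * Real.sin (μ * t))) s t := by
  have h := ((hasDerivAt_id t).const_mul μ).cos
  exact h.hasDerivWithinAt.congr_deriv (by simp; ring)

theorem hasDerivWithinAt_sin_mul (μ t : ℝ) (s : Set ℝ) :
    HasDerivWithinAt (fun t => Real.sin (μ * t)) (μ * Real.cos (μ * t)) s t := by
  have h := ((hasDerivAt_id t).const_mul μ).sin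
  exact h.hasDerivWithinAt.congr_deriv (by simp; ring)

/-- Variation of constants. -/
theorem hasDerivWithinAt_amplitudes {l c f t : ℝ} (hl : l ≠ 0) {u v : ℝ → ℝ} {s : Set ℝ}
    (hu : HasDerivWithinAt u (v t) s t) (hv : HasDerivWithinAt v (-(l ^ 2 * u t) - f) s t) :
    HasDerivWithinAt (fun t => (u t * Real.cos (l * t) - v t / l * Real.sin (l * t) - c,
        u t * Real.sin (l * t) + v t / l * Real.cos (l * t)))
      (f / l * Real.sin (l * t), -(f / l * Real.cos (l * t))) s t := by
  have hc := hasDerivWithinAt_cos_mul l t s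
  have hs := hasDerivWithinAt_sin_mul l t s
  have h1 := ((hu.mul hc).sub ((hv.div_const l).mul hs)).sub_const c
  have h2 := (hu.mul hs).add ((hv.div_const l).mul hc)
  refine (h1.prodMk h2).congr_deriv ?_
  ext <;> dsimp only <;> field_simp <;> ring

theorem abs_mul_cos_add_mul_sin_le {x y D : ℝ} (hx : |x| ≤ D) (hy : |y| ≤ D) (θ φ : ℝ) :
    |x * Real.cos θ + y * Real.sin φ| ≤ 2 * D := by
  have h1 := mul_le_of_le_one_right (abs_nonneg x) (Real.abs_cos_le_one θ)
  have h2 := mul_le_of_le_one_right (abs_nonneg y) (Real.abs_sin_le_one φ)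
  calc _ ≤ |x * Real.cos θ| + |y * Real.sin φ| := abs_add_le _ _
    _ ≤ 2 * D := by rw [abs_mul, abs_mul]; linarith

/-- Gronwall estimate for the distance to the unperturbed orbit. -/
theorem abs_sub_unperturbed_le (hpos : ∀ k, 0 < lam k) {C : ℝ} (hC : 0 < C)
    (hbound : ∀ k, ∀ x : Fin N → ℝ, ∀ D, 0 ≤ D → (∀ j, |x j| ≤ |a j| + 2 * D) →
      |max (∑ j, A k j * x j - b k) 0| / lam k ≤ C * (D + 1))
    {ε : ℝ} (hε : 0 < ε) {u v : Fin N → ℝ → ℝ} (h0 : ∀ k, u k 0 = a k ∧ v k 0 = 0)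
    (h : ∀ k, ∀ t ∈ Ici (0 : ℝ), HasDerivWithinAt (u k) (v k t) (Ici 0) t ∧
      HasDerivWithinAt (v k)
        (-(lam k ^ 2 * u k t) - ε * max (∑ j, A k j * u j t - b k) 0) (Ici 0) t)
    {t T : ℝ} (ht : t ∈ Icc 0 T) (k : Fin N) :
    |u k t - a k * Real.cos (lam k * t)| ≤ 2 * (Real.exp (C * ε * T) - 1) ∧
    |v k t + a k * lam k * Real.sin (lam k * t)| ≤
      lam k * (2 * (Real.exp (C * ε * T) - 1)) := by
  set Y : ℝ → Fin N → ℝ × ℝ := fun t k =>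
    (u k t * Real.cos (lam k * t) - v k t / lam k * Real.sin (lam k * t) - a k,
      u k t * Real.sin (lam k * t) + v k t / lam k * Real.cos (lam k * t)) with hY
  set F : ℝ → Fin N → ℝ := fun t k => ε * max (∑ j, A k j * u j t - b k) 0 with hF
  have hYd (t : ℝ) (ht : 0 ≤ t) : HasDerivWithinAt Y (fun k =>
      (F t k / lam k * Real.sin (lam k * t), -(F t k / lam k * Real.cos (lam k * t)))) (Ici 0) t :=
    hasDerivWithinAt_pi.2 fun k =>
      hasDerivWithinAt_amplitudes (hpos k).ne' (h k t ht).1 (h k t ht).2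
  have hfst (t : ℝ) (k) : |(Y t k).1| ≤ ‖Y t‖ := (norm_fst_le (Y t k)).trans (norm_le_pi_norm _ k)
  have hsnd (t : ℝ) (k) : |(Y t k).2| ≤ ‖Y t‖ := (norm_snd_le (Y t k)).trans (norm_le_pi_norm _ k)
  have hu (t : ℝ) (k) : u k t - a k * Real.cos (lam k * t) =
      (Y t k).1 * Real.cos (lam k * t) + (Y t k).2 * Real.sin (lam k * t) := by
    simp only [hY]
    linear_combination -u k t * Real.sin_sq_add_cos_sq (lam k * t)
  have hv (t : ℝ) (k) : v k t + a k * lam k * Real.sin (lam k * t) =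
      lam k * ((Y t k).2 * Real.cos (lam k * t) + (-(Y t k).1) * Real.sin (lam k * t)) := by
    have hk := (hpos k).ne'
    simp only [hY]
    field_simp
    linear_combination -v k t * Real.sin_sq_add_cos_sq (lam k * t)
  have hbd (t : ℝ) (k) : |F t k / lam k| ≤ C * ε * ‖Y t‖ + C * ε := by
    have hk := hpos k
    have hb := hbound k (fun j => u j t) ‖Y t‖ (norm_nonneg _) fun j => by
      have h1 := abs_mul_cos_add_mul_sin_le (hfst t j) (hsnd t j) (lam j * t) (lam j * t)
      rw [← hu] at h1
      have h2 := mul_le_of_le_one_right (abs_nonneg (a j)) (Real.abs_cos_le_one (lam j * t))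
      rw [← abs_mul] at h2
      have h3 := abs_sub_abs_le_abs_sub (u j t) (a j * Real.cos (lam j * t))
      linarith
    rw [hF, abs_div, abs_mul, abs_of_pos hε, abs_of_pos hk, mul_div_assoc]
    calc _ ≤ ε * (C * (‖Y t‖ + 1)) := by gcongr
      _ = _ := by ring
  have hG := norm_le_gronwallBound_of_norm_deriv_right_le (f := Y) (δ := 0) (K := C * ε)
    (ε := C * ε) (a := 0) (b := T)
    (fun t ht => ((hYd t ht.1).continuousWithinAt).mono Icc_subset_Ici_self)
    (fun t ht => (hYd t ht.1).mono (Ici_subset_Ici.2 ht.1))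
    (by
      have : Y 0 = 0 := by
        ext k <;> simp [hY, h0]
      simp [this])
    (fun t _ => by
      refine (pi_norm_le_iff_of_nonneg (by positivity)).2 fun k => ?_
      refine norm_prod_le_iff.2 ⟨?_, ?_⟩
      · rw [Real.norm_eq_abs, abs_mul]
        exact (mul_le_of_le_one_right (abs_nonneg _) (Real.abs_sin_le_one _)).trans (hbd t k)
      · rw [Real.norm_eq_abs, abs_neg, abs_mul]
        exact (mul_le_of_le_one_right (abs_nonneg _) (Real.abs_cos_le_one _)).trans (hbd t k)) t ht
  rw [gronwallBound_of_K_ne_0 (by positivity), div_self (by positivity)] at hG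
  have hG' : ‖Y t‖ ≤ Real.exp (C * ε * T) - 1 := by
    refine hG.trans ?_
    have : Real.exp (C * ε * (t - 0)) ≤ Real.exp (C * ε * T) := by
      gcongr
      linarith [ht.2]
    linarith
  constructor
  · rw [hu]
    exact abs_mul_cos_add_mul_sin_le ((hfst t k).trans hG') ((hsnd t k).trans hG') _ _
  · rw [hv, abs_mul, abs_of_pos (hpos k)]
    gcongr
    · exact (hpos k).le
    · exact abs_mul_cos_add_mul_sin_le ((hsnd t k).trans hG')
        ((abs_neg _).trans_le ((hfst t k).trans hG')) _ _

theorem abs_mul_cos_sub_mul_cos_le (c d μ l : ℝ) {t T : ℝ} (ht : t ∈ Icc 0 T) :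
    |c * Real.cos (l * t) - d * Real.cos (μ * t)| ≤ |d| * (|l - μ| * T) + |c - d| := by
  have h1 : |Real.cos (l * t) - Real.cos (μ * t)| ≤ |l - μ| * T := by
    refine (Real.abs_cos_sub_cos_le _ _).trans ?_
    rw [← sub_mul, abs_mul, abs_of_nonneg ht.1]
    gcongr
    exact ht.2
  rw [show c * Real.cos (l * t) - d * Real.cos (μ * t) =
    d * (Real.cos (l * t) - Real.cos (μ * t)) + (c - d) * Real.cos (l * t) by ring]
  refine (abs_add_le _ _).trans ?_
  rw [abs_mul, abs_mul]
  gcongr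
  exact mul_le_of_le_one_right (abs_nonneg _) (Real.abs_cos_le_one _)

theorem abs_mul_sin_sub_mul_sin_le (c d μ l : ℝ) {t T : ℝ} (ht : t ∈ Icc 0 T) :
    |c * Real.sin (l * t) - d * Real.sin (μ * t)| ≤ |d| * (|l - μ| * T) + |c - d| := by
  have h1 : |Real.sin (l * t) - Real.sin (μ * t)| ≤ |l - μ| * T := by
    refine (Real.abs_sin_sub_sin_le _ _).trans ?_
    rw [← sub_mul, abs_mul, abs_of_nonneg ht.1]
    gcongr
    exact ht.2
  rw [show c * Real.sin (l * t) - d * Real.sin (μ * t) =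
    d * (Real.sin (l * t) - Real.sin (μ * t)) + (c - d) * Real.sin (l * t) by ring]
  refine (abs_add_le _ _).trans ?_
  rw [abs_mul, abs_mul]
  gcongr
  exact mul_le_of_le_one_right (abs_nonneg _) (Real.abs_sin_le_one _)

theorem exists_sobolevNormTwoInfty_sub_le (hpos : ∀ k, 0 < lam k) (a b : Fin N → ℝ)
    (A : Matrix (Fin N) (Fin N) ℝ) :
    ∃ C : ℝ, ∀ ε > 0, ∀ u : Fin N → ℝ → ℝ, IsSolution lam a b A ε u → ∀ T > 0, ∀ k, ∀ μ : ℝ,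
      sobolevNormTwoInfty (Ioo 0 T) (fun t => u k t - a k * Real.cos (μ * t)) ≤
        ENNReal.ofReal (2 * (Real.exp (C * ε * T) - 1) +
          (|a k| * (|lam k - μ| * T) + |a k - a k|)) +
        ENNReal.ofReal (lam k * (2 * (Real.exp (C * ε * T) - 1)) +
          (|a k * μ| * (|lam k - μ| * T) + |a k * lam k - a k * μ|)) +
        ENNReal.ofReal (lam k ^ 2 * (2 * (Real.exp (C * ε * T) - 1)) +
          ε * (C * Real.exp (C * ε * T)) +
          (|a k * μ ^ 2| * (|lam k - μ| * T) + |a k * lam k ^ 2 - a k * μ ^ 2|)) := by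
  obtain ⟨C, hC, hbound⟩ := exists_force_bound hpos a b A
  refine ⟨C, fun ε hε u hu T hT k μ => ?_⟩
  obtain ⟨v, h0, h⟩ := hu
  have hest {t : ℝ} (ht : t ∈ Icc 0 T) (k : Fin N) := abs_sub_unperturbed_le hpos hC
    (fun k x D hD hx => (hbound k x D hD hx).2) hε h0 h ht k
  have hforce {t : ℝ} (ht : t ∈ Icc 0 T) :
      |max (∑ j, A k j * u j t - b k) 0| ≤ C * Real.exp (C * ε * T) := by
    have := (hbound k (fun j => u j t) (Real.exp (C * ε * T) - 1)
      (sub_nonneg.2 (Real.one_le_exp (by positivity))) fun j => by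
        have h1 := (hest ht j).1
        have h2 := mul_le_of_le_one_right (abs_nonneg (a j)) (Real.abs_cos_le_one (lam j * t))
        rw [← abs_mul] at h2
        have h3 := abs_sub_abs_le_abs_sub (u j t) (a j * Real.cos (lam j * t))
        linarith).1
    rwa [sub_add_cancel] at this
  have hcu (j : Fin N) : ContinuousOn (u j) (Icc 0 T) := fun t ht =>
    (h j t ht.1).1.continuousWithinAt.mono Icc_subset_Ici_self
  have hcv (j : Fin N) : ContinuousOn (v j) (Icc 0 T) := fun t ht =>
    (h j t ht.1).2.continuousWithinAt.mono Icc_subset_Ici_self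
  refine sobolevNormTwoInfty_le hT.le (g := fun t => v k t + a k * μ * Real.sin (μ * t))
    (h := fun t => -(lam k ^ 2 * u k t) - ε * max (∑ j, A k j * u j t - b k) 0 +
      a k * μ ^ 2 * Real.cos (μ * t)) (by fun_prop) (by fun_prop) (by fun_prop)
    (fun t ht => ?_) (fun t ht => ?_) (fun t ht => ?_) (fun t ht => ?_) fun t ht => ?_
  · have hd := ((h k t ht.1.le).1.sub
      ((hasDerivWithinAt_cos_mul μ t (Ici 0)).const_mul (a k))).hasDerivAt (Ici_mem_nhds ht.1)
    exact hd.congr_deriv (by ring)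
  · have hd := ((h k t ht.1.le).2.add
      ((hasDerivWithinAt_sin_mul μ t (Ici 0)).const_mul (a k * μ))).hasDerivAt
      (Ici_mem_nhds ht.1)
    exact hd.congr_deriv (by ring)
  · have ht' := Ioo_subset_Icc_self ht
    rw [show u k t - a k * Real.cos (μ * t) = (u k t - a k * Real.cos (lam k * t)) +
      (a k * Real.cos (lam k * t) - a k * Real.cos (μ * t)) by ring]
    exact (abs_add_le _ _).trans
      (add_le_add (hest ht' k).1 (abs_mul_cos_sub_mul_cos_le _ _ _ _ ht'))
  · have ht' := Ioo_subset_Icc_self ht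
    rw [show v k t + a k * μ * Real.sin (μ * t) =
      (v k t + a k * lam k * Real.sin (lam k * t)) -
      (a k * lam k * Real.sin (lam k * t) - a k * μ * Real.sin (μ * t)) by ring]
    exact (abs_sub _ _).trans
      (add_le_add (hest ht' k).2 (abs_mul_sin_sub_mul_sin_le _ _ _ _ ht'))
  · have ht' := Ioo_subset_Icc_self ht
    rw [show -(lam k ^ 2 * u k t) - ε * max (∑ j, A k j * u j t - b k) 0 +
        a k * μ ^ 2 * Real.cos (μ * t) =
      -(lam k ^ 2 * (u k t - a k * Real.cos (lam k * t)) +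
        ε * max (∑ j, A k j * u j t - b k) 0 +
        (a k * lam k ^ 2 * Real.cos (lam k * t) - a k * μ ^ 2 * Real.cos (μ * t))) by ring,
      abs_neg]
    refine (abs_add_three _ _ _).trans (add_le_add (add_le_add ?_ ?_)
      (abs_mul_cos_sub_mul_cos_le _ _ _ _ ht'))
    · rw [abs_mul, abs_of_nonneg (sq_nonneg _)]
      gcongr
      exact (hest ht' k).1
    · rw [abs_mul, abs_of_pos hε]
      gcongr
      exact hforce ht'

theorem tendsto_sobolevNormTwoInfty_sub (hpos : ∀ k, 0 < lam k) {u : ℝ → Fin N → ℝ → ℝ}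
    (hu : ∀ᶠ ε in 𝓝[>] (0 : ℝ), IsSolution lam a b A ε (u ε)) {T : ℝ → ℝ}
    (hT : Tendsto T (𝓝[>] 0) atTop) (hεT : Tendsto (fun ε => ε * T ε) (𝓝[>] 0) (𝓝 0))
    (k : Fin N) (σ : ℝ) :
    Tendsto (fun ε => sobolevNormTwoInfty (Ioo 0 (T ε))
      (fun t => u ε k t - a k * Real.cos ((lam k + ε * σ) * t))) (𝓝[>] 0) (𝓝 0) := by
  obtain ⟨C, hC⟩ := exists_sobolevNormTwoInfty_sub_le hpos a b A
  have hε : Tendsto (fun ε : ℝ => ε) (𝓝[>] 0) (𝓝 0) := tendsto_nhdsWithin_of_tendsto_nhds tendsto_id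
  have hμ : Tendsto (fun ε : ℝ => lam k + ε * σ) (𝓝[>] 0) (𝓝 (lam k)) := by
    simpa using (hε.mul_const σ).const_add (lam k)
  have hexp : Tendsto (fun ε => Real.exp (C * ε * T ε)) (𝓝[>] 0) (𝓝 1) := by
    simpa [mul_assoc] using (hεT.const_mul C).rexp
  have hD : Tendsto (fun ε => 2 * (Real.exp (C * ε * T ε) - 1)) (𝓝[>] 0) (𝓝 0) := by
    simpa using (hexp.sub_const 1).const_mul 2
  have hR : Tendsto (fun ε => |lam k - (lam k + ε * σ)| * T ε) (𝓝[>] 0) (𝓝 0) := by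
    have := hεT.const_mul |σ|
    rw [mul_zero] at this
    refine this.congr' ?_
    filter_upwards [self_mem_nhdsWithin] with ε hε
    rw [sub_add_cancel_left, abs_neg, abs_mul, abs_of_pos (mem_Ioi.1 hε)]
    ring
  have hshift {c : ℝ → ℝ} (hc : Continuous c) : Tendsto (fun ε =>
      |c (lam k + ε * σ)| * (|lam k - (lam k + ε * σ)| * T ε) +
        |c (lam k) - c (lam k + ε * σ)|) (𝓝[>] 0) (𝓝 0) := by
    have hcμ := (hc.tendsto (lam k)).comp hμ
    simpa using (hcμ.abs.mul hR).add (hcμ.const_sub (c (lam k))).abs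
  have hB₀ := hD.add (hshift (c := fun _ => a k) (by fun_prop))
  have hB₁ := (hD.const_mul (lam k)).add (hshift (c := fun μ => a k * μ) (by fun_prop))
  have hB₂ := ((hD.const_mul (lam k ^ 2)).add (hε.mul (hexp.const_mul C))).add
    (hshift (c := fun μ => a k * μ ^ 2) (by fun_prop))
  simp only [mul_zero, zero_mul, add_zero] at hB₀ hB₁ hB₂
  have hB := ((ENNReal.tendsto_ofReal hB₀).add (ENNReal.tendsto_ofReal hB₁)).add
    (ENNReal.tendsto_ofReal hB₂)
  simp only [ENNReal.ofReal_zero, add_zero] at hB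
  refine tendsto_of_tendsto_of_tendsto_of_le_of_le' tendsto_const_nhds hB
    (.of_forall fun _ => zero_le) ?_
  filter_upwards [hu, hT.eventually_gt_atTop 0, self_mem_nhdsWithin] with ε h1 h2 h3
  exact hC ε h3 (u ε) h1 (T ε) h2 k _

end UnilateralSpring

theorem theorem4p3 {N : ℕ} (lam a b : Fin N → ℝ) (A : Matrix (Fin N) (Fin N) ℝ)
    (hpos : ∀ k, 0 < lam k) (hind : LinearIndependent ℤ lam) :
    (∀ k, ∃ m : ℝ, Tendsto (UnilateralSpring.resonantMean lam a b A k) atTop (𝓝 m)) ∧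
    (∀ k, a k ≠ 0 → b k = 0 →
      UnilateralSpring.frequencyCorrection lam a b A k = A k k / (4 * lam k)) ∧
    ∀ u : ℝ → Fin N → ℝ → ℝ,
      (∀ᶠ ε in 𝓝[>] (0 : ℝ), UnilateralSpring.IsSolution lam a b A ε (u ε)) →
      ∀ T : ℝ → ℝ, Tendsto T (𝓝[>] 0) atTop →
        Tendsto (fun ε => ε * T ε) (𝓝[>] 0) (𝓝 0) →
        ∀ k, Tendsto
          (fun ε => UnilateralSpring.sobolevNormTwoInfty (Ioo 0 (T ε))
            (fun t => u ε k t - a k * Real.cos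
              ((lam k + ε * UnilateralSpring.frequencyCorrection lam a b A k) * t)))
          (𝓝[>] 0) (𝓝 0) := by
  refine ⟨UnilateralSpring.exists_tendsto_resonantMean lam a b A, fun k ha hb => ?_,
    fun u hu T hT hεT k => UnilateralSpring.tendsto_sobolevNormTwoInfty_sub hpos hu hT hεT k _⟩
  have hk := (hpos k).ne'
  rw [UnilateralSpring.frequencyCorrection,
    (UnilateralSpring.tendsto_resonantMean_of_eq_zero hpos hind a A hb).limUnder_eq]
  field_simp
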